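/- Let $d\ge 2$ and $n\ge d-1$ be integers. Let $\Delta_{n-1}=\{w\in\mathbb{R}^n_{\ge 0} : w_1+\cdots+w_n=1\}$, let $p_j(w)=\sum_{i=1}^n w_i^j$, and let $\Pi_{n,d}=\{(p_2(w),\ldots,p_d(w)) : w\in\Delta_{n-1}\}\subset\mathbb{R}^{d-1}$ be the Vandermonde cell. Let $M_{n,d}$ be the set of multiplicity vectors $m=(m_0,\ldots,m_{d-1})$ of nonnegative integers with $m_0+m_1+\cdots+m_{d-1}=n$ such that - either $m_0\ge 0$, $m_i=1$ for all odd $i$, and $m_i\ge 1$ for all even $i\ge 2$ (where $1\le i\le d-1$); - or $m_0=0$, $m_i=1$ for all even $i\ge 2$, and $m_i\ge 1$ for all odd $i$ (where $1\le i\le d-1$). For $m\in M_{n,d}$ let the boundary component $B_m$ be the set of all $(p_2(w),\ldots,p_d(w))$ where $w\in\Delta_{n-1}$ has the form $$w=(\underbrace{0,\ldots,0}_{m_0},\underbrace{x_1,\ldots,x_1}_{m_1},\ldots,\underbrace{x_{d-1},\ldots,x_{d-1}}_{m_{d-1}}),\qquad 0\le x_1\le\cdots\le x_{d-1}.$$ Then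 the topological boundary of $\Pi_{n,d}$ in $\mathbb{R}^{d-1}$ is $\bigcup_{m\in M_{n,d}}B_m$, and for every $m\in M_{n,d}$ the map $$(x_1,\ldots,x_{d-1})\longmapsto\left(\sum_{i=1}^{d-2} m_i x_i^j+m_{d-1}\left(\frac{1}{m_{d-1}}-\sum_{i=1}^{d-2}\frac{m_i}{m_{d-1}}x_i\right)^{j}\right)_{j=2,\ldots,d}$$ is a bijection from $\{x\in\mathbb{R}^{d-1} : 0\le x_1\le\cdots\le x_{d-1},\ \sum_{i=1}^{d-1}m_i x_i=1\}$ onto $B_m$. -/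

import Mathlib

/-!
Throughout, the degree of the Vandermonde map is written `d = k + 2` (so `d ≥ 2`), where
`k = d - 2` is the number of free parameters of a boundary component. Thus

* points of `ℝ^(d-1)` (coordinates indexed by the exponents `2, …, d`) have type `Fin (k+1) → ℝ`;
* multiplicity vectors `(m_0, …, m_{d-1})` have type `Fin (k+2) → ℕ`;
* value vectors `(x_1, …, x_{d-1})` have type `Fin (k+1) → ℝ`, where `x i` is the value whose
  multiplicity is `m i.succ`.
-/

namespace Vandermonde

/-- The Vandermonde map `ℝ^n → ℝ^d`, `w ↦ (p_1(w), …, p_d(w))`, with `p_a(w) = ∑ w_i ^ a`. -/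
def vandermondeMap (n d : ℕ) (w : Fin n → ℝ) : Fin d → ℝ :=
  fun j => ∑ i, w i ^ ((j : ℕ) + 1)

/-- The map `w ↦ (p_2(w), …, p_d(w))`, `d = k + 2`: the Vandermonde map followed by the projection
that forgets the first coordinate. -/
def reducedMap (n k : ℕ) (w : Fin n → ℝ) : Fin (k + 1) → ℝ :=
  Fin.tail (vandermondeMap n (k + 2) w)

/-- The Vandermonde cell `Π_{n,d}`, `d = k + 2`, as a subset of `ℝ^(d-1)`: the image of the
standard probability simplex in `ℝ^n`. -/
def vandermondeCell (n k : ℕ) : Set (Fin (k + 1) → ℝ) :=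
  reducedMap n k '' stdSimplex ℝ (Fin n)

/-- First parity pattern: `m_0 ≥ 0`, `m_i = 1` for odd `i`, `m_i ≥ 1` for even `i ≥ 2`. -/
def IsFirstPattern {k : ℕ} (m : Fin (k + 2) → ℕ) : Prop :=
  ∀ i : Fin (k + 1), (Odd (i.succ : ℕ) → m i.succ = 1) ∧ (Even (i.succ : ℕ) → 1 ≤ m i.succ)

/-- Second parity pattern: `m_0 = 0`, `m_i = 1` for even `i ≥ 2`, `m_i ≥ 1` for odd `i`. -/
def IsSecondPattern {k : ℕ} (m : Fin (k + 2) → ℕ) : Prop :=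
  m 0 = 0 ∧
  ∀ i : Fin (k + 1), (Even (i.succ : ℕ) → m i.succ = 1) ∧ (Odd (i.succ : ℕ) → 1 ≤ m i.succ)

/-- The admissible multiplicity vectors for `n` coordinates: vectors `(m_0, …, m_{d-1})` of total
`n` that satisfy one of the two parity patterns. -/
def multiplicityVectors (n k : ℕ) : Set (Fin (k + 2) → ℕ) :=
  {m | ∑ i, m i = n ∧ (IsFirstPattern m ∨ IsSecondPattern m)}

/-- `w = (0, …, 0, x_1, …, x_1, …, x_{d-1}, …, x_{d-1})`, where `0` is repeated `m_0` times and
`x_i` is repeated `m_i` times (positions are counted from `0`). -/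
def IsBlockVector {n k : ℕ} (m : Fin (k + 2) → ℕ) (x : Fin (k + 1) → ℝ) (w : Fin n → ℝ) : Prop :=
  ∀ (i : Fin (k + 2)) (j : Fin n),
    ∑ l ∈ Finset.Iio i, m l ≤ (j : ℕ) → (j : ℕ) < ∑ l ∈ Finset.Iic i, m l →
      w j = (Fin.cons 0 x : Fin (k + 2) → ℝ) i

/-- The boundary component with multiplicity vector `m`: the image of those points of the simplex
that have the form `(0, …, 0, x_1, …, x_1, …, x_{d-1}, …, x_{d-1})` with multiplicities `m` and
`0 ≤ x_1 ≤ ⋯ ≤ x_{d-1}`. -/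
def boundaryComponent (n : ℕ) {k : ℕ} (m : Fin (k + 2) → ℕ) : Set (Fin (k + 1) → ℝ) :=
  reducedMap n k '' {w | w ∈ stdSimplex ℝ (Fin n) ∧
    ∃ x : Fin (k + 1) → ℝ, (∀ i, 0 ≤ x i) ∧ Monotone x ∧ IsBlockVector m x w}

/-- The parameter domain: `0 ≤ x_1 ≤ ⋯ ≤ x_{d-1}` and `∑_{i=1}^{d-1} m_i x_i = 1`. -/
def paramDomain {k : ℕ} (m : Fin (k + 2) → ℕ) : Set (Fin (k + 1) → ℝ) :=
  {x | (∀ i, 0 ≤ x i) ∧ Monotone x ∧ ∑ i, (m i.succ : ℝ) * x i = 1}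

/-- The map `(∑_{i=1}^{d-2} m_i x_i^j + (1/m_{d-1} - ∑_{i=1}^{d-2} (m_i/m_{d-1}) x_i)^j)_{j=2..d}`
with the last power weighted by its multiplicity `m_{d-1}`; it depends on `x_1, …, x_{d-2}` only. -/
noncomputable def boundaryParam {k : ℕ} (m : Fin (k + 2) → ℕ) (x : Fin (k + 1) → ℝ) :
    Fin (k + 1) → ℝ :=
  fun j => ∑ i : Fin k, (m i.castSucc.succ : ℝ) * x i.castSucc ^ ((j : ℕ) + 2) +
    (m (Fin.last (k + 1)) : ℝ) *
      (1 / (m (Fin.last (k + 1)) : ℝ) -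
        ∑ i : Fin k, (m i.castSucc.succ : ℝ) / (m (Fin.last (k + 1)) : ℝ) * x i.castSucc)
        ^ ((j : ℕ) + 2)

end Vandermonde

namespace Vandermonde

/-! Put K = d - 1 = k + 1. Both parity patterns say that every second block is a single position;
`IsAlternating` records the parity e of the blocks that may repeat.

Components lie on the boundary and are parametrized bijectively because an alternating vector w is
the unique extremum of p_d among nonnegative vectors with the same p_1, …, p_K. For a sorted
competitor w', `exists_monic_sign_eq` builds a monic q of degree K which, up to a global sign, has
the sign of w'_j - w_j between w_j and w'_j. Then ∑_j ∫ q from w_j to w'_j has a fixed sign, and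
since the lower power sums agree it equals (p_d(w') - p_d(w))/d (`powerSum_compare`).

Conversely, let u in the simplex have power sums nearest to a point outside the cell. The gradient
polynomial G of the squared distance, of degree at most K, takes one value λ at all positive
coordinates and values ≥ λ at zero coordinates, and G' ≥ 0 at repeated positive coordinates. Signs
of G - λ at 0 and of G' at consecutive simple roots are governed by the number of roots to the
right, so these inequalities limit which values may repeat; `exists_slowWalk_le` turns this count
into an alternating block structure. Such nearest points are dense enough: every frontier point is a
limit of them, and the finite union of compact components is closed. -/

open Polynomial Filter Topology

/-! ### Separating polynomials and comparison of power sums. -/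

/-- The product `∏ (t - c i)` over a monotone sequence alternates in sign on the intervals between
consecutive `c i`. -/
lemma exists_sign_prod_sub {c : ℕ → ℝ} (hc : Monotone c) (K : ℕ) (t : ℝ) :
    ∃ b ≤ K, (b ≠ 0 → c b ≤ t) ∧ (b < K → t < c (b + 1)) ∧
      0 ≤ (-1 : ℝ) ^ (K + b) * ∏ i ∈ Finset.range K, (t - c (i + 1)) := by
  classical
  obtain ⟨b, hbK, hb, hmax⟩ : ∃ b ≤ K, (b ≠ 0 → c b ≤ t) ∧ ∀ i, b < i → i ≤ K → t < c i := by
    refine ⟨Nat.findGreatest (fun i => c i ≤ t) K, Nat.findGreatest_le K, fun h => ?_,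
      fun i hi hiK => ?_⟩
    · exact Nat.findGreatest_of_ne_zero (P := fun i => c i ≤ t) rfl h
    · exact not_le.1 (Nat.findGreatest_is_greatest hi hiK)
  refine ⟨b, hbK, hb, fun h => hmax _ (Nat.lt_succ_self b) h, ?_⟩
  obtain ⟨r, rfl⟩ := Nat.exists_eq_add_of_le hbK
  rw [Finset.prod_range_add]
  have h1 : 0 ≤ ∏ i ∈ Finset.range b, (t - c (i + 1)) := by
    refine Finset.prod_nonneg fun i hi => sub_nonneg.2 ?_
    rw [Finset.mem_range] at hi
    exact (hc (by omega)).trans (hb (by omega))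
  have h2 : ∏ i ∈ Finset.range r, (t - c (b + i + 1)) =
      (-1) ^ r * ∏ i ∈ Finset.range r, (c (b + i + 1) - t) := by
    rw [← Finset.card_range r, ← Finset.prod_const, Finset.card_range, ← Finset.prod_mul_distrib]
    exact Finset.prod_congr rfl fun i _ => by ring
  have h3 : 0 ≤ ∏ i ∈ Finset.range r, (c (b + i + 1) - t) := by
    refine Finset.prod_nonneg fun i hi => sub_nonneg.2 (hmax _ (by omega) ?_).le
    rw [Finset.mem_range] at hi
    omega
  have h4 : (-1 : ℝ) ^ (b + r + b) * (-1) ^ r = 1 := by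
    rw [← pow_add]
    exact Even.neg_one_pow ⟨b + r, by ring⟩
  rw [h2]
  calc (0 : ℝ) ≤ (∏ i ∈ Finset.range b, (t - c (i + 1))) *
        ∏ i ∈ Finset.range r, (c (b + i + 1) - t) := mul_nonneg h1 h3
    _ = ((-1 : ℝ) ^ (b + r + b) * (-1) ^ r) * ((∏ i ∈ Finset.range b, (t - c (i + 1))) *
        ∏ i ∈ Finset.range r, (c (b + i + 1) - t)) := by rw [h4, one_mul]
    _ = _ := by ring

/-- Let `w = x ∘ β` be a vector with block structure `β` in which the blocks whose index does not
have the parity of `e` consist of a single position, where `w'` takes the value `v b`. Then some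
monic polynomial of degree `K` has, up to a global sign, the sign of `w' j - w j` between `w j` and
`w' j`, for every `j`. -/
lemma exists_monic_sign_eq {ι : Type*} (K e : ℕ) (β : ι → ℕ) (hβK : ∀ j, β j ≤ K)
    (x v : ℕ → ℝ) (hx : Monotone x) (hx0 : x 0 = 0) (w' : ι → ℝ) (hw' : ∀ j, 0 ≤ w' j)
    (hv : ∀ b, 1 ≤ b → b ≤ K → b % 2 ≠ e % 2 →
      (∀ j, β j ≤ b → w' j ≤ v b) ∧ ∀ j, b ≤ β j → v b ≤ w' j)
    (he : e % 2 = 1 → ∀ j, 1 ≤ β j) (htop : ∀ j, w' j ≤ x (K + 1)) :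
    ∃ q : ℝ[X], q.Monic ∧ q.natDegree = K ∧ ∀ j t,
      (x (β j) < t → t < w' j → 0 ≤ (-1) ^ (K + e) * q.eval t) ∧
      (w' j < t → t < x (β j) → (-1) ^ (K + e) * q.eval t ≤ 0) := by
  classical
  -- The roots of q: at a repeatable block the value of w, at a single-position block the value v b
  -- of w', clamped between the neighbouring values of w so that the roots stay in order.
  set c : ℕ → ℝ := fun b =>
    if b % 2 = e % 2 then x b else max (x (b - 1)) (min (v b) (x (b + 1))) with hcdef
  have hcrep : ∀ b, b % 2 = e % 2 → c b = x b := fun b hb => if_pos hb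
  have hcsing : ∀ b, b % 2 ≠ e % 2 → c b = max (x (b - 1)) (min (v b) (x (b + 1))) :=
    fun b hb => if_neg hb
  have hc : Monotone c := by
    refine monotone_nat_of_le_succ fun b => ?_
    by_cases hb : b % 2 = e % 2
    · rw [hcrep b hb, hcsing (b + 1) (by omega)]
      exact le_max_left _ _
    · rw [hcsing b hb, hcrep (b + 1) (by omega)]
      exact max_le (hx (by omega)) (min_le_right _ _)
  refine ⟨∏ i ∈ Finset.range K, (X - C (c (i + 1))), monic_prod_of_monic _ _ fun i _ =>
    monic_X_sub_C _, ?_, fun j t => ?_⟩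
  · rw [natDegree_prod_of_monic _ _ fun i _ => monic_X_sub_C _]
    simp
  obtain ⟨b, hbK, hb, hb', hsign⟩ := exists_sign_prod_sub hc K t
  have heval : (∏ i ∈ Finset.range K, (X - C (c (i + 1)))).eval t =
      ∏ i ∈ Finset.range K, (t - c (i + 1)) := by
    simp [eval_prod]
  rw [heval]
  constructor
  · intro h1 h2
    -- Here t lies between the b-th and the next root. If b were a single-position block, then t < x
    -- (b + 1) gives β j ≤ b, hence t < w' j ≤ v b, so t would lie below c b.
    have hbe : b % 2 = e % 2 := by
      by_contra hbe
      rcases Nat.eq_zero_or_pos b with rfl | hpos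
      · have hK : 0 < K := (he (by omega) j).trans (hβK j)
        have h3 := hb' hK
        rw [hcrep (0 + 1) (by omega)] at h3
        exact absurd (hx (he (by omega) j)) (not_le.2 (h1.trans h3))
      · have h3 := hb hpos.ne'
        rw [hcsing b hbe] at h3
        have hlt : t < x (b + 1) := by
          rcases hbK.eq_or_lt with rfl | hlt
          · exact h2.trans_le (htop j)
          · have := hb' hlt
            rwa [hcrep (b + 1) (by omega)] at this
        have hβ : β j ≤ b := by
          by_contra hcon
          exact absurd (hx (Nat.succ_le_of_lt (not_le.1 hcon))) (not_le.2 (h1.trans hlt))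
        have h4 := (hv b hpos hbK hbe).1 j hβ
        exact absurd h3 (not_le.2 (lt_max_of_lt_right (lt_min (h2.trans_le h4) hlt)))
    rwa [show (-1 : ℝ) ^ (K + e) = (-1) ^ (K + b) from neg_one_pow_congr (by
      rw [Nat.even_iff, Nat.even_iff]
      omega)]
  · intro h1 h2
    have hbe : b % 2 ≠ e % 2 := by
      -- If b had the parity of e, then b < β j, so v (b + 1) ≤ w' j < t, and the next root would
      -- not exceed t.
      intro hbe
      have hxb : x b ≤ t := by
        rcases Nat.eq_zero_or_pos b with rfl | hpos
        · rw [hx0]; exact (hw' j).trans h1.le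
        · have := hb hpos.ne'
          rwa [hcrep b hbe] at this
      have hβ : b < β j := by
        by_contra hcon
        exact absurd (hx (not_lt.1 hcon)) (not_le.2 (hxb.trans_lt h2))
      have hlt : b < K := hβ.trans_le (hβK j)
      have h3 := hb' hlt
      rw [hcsing (b + 1) (by omega)] at h3
      have h4 := (hv (b + 1) (by omega) hlt (by omega)).2 j hβ
      refine absurd h3 (not_lt.2 (max_le hxb ((min_le_left _ _).trans (h4.trans h1.le))))
    have : (-1 : ℝ) ^ (K + e) = -(-1) ^ (K + b) := by
      rw [← neg_one_mul ((-1 : ℝ) ^ (K + b)), ← pow_succ']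
      refine neg_one_pow_congr ?_
      rw [Nat.even_iff, Nat.even_iff]
      omega
    rw [this, neg_mul]
    exact neg_nonpos.2 hsign

lemma integral_eval_eq_sum {q : ℝ[X]} {K : ℕ} (hq : q.natDegree = K) (a b : ℝ) :
    ∫ t in a..b, q.eval t =
      ∑ i ∈ Finset.range (K + 1), q.coeff i * ((b ^ (i + 1) - a ^ (i + 1)) / (i + 1)) := by
  have h : ∀ t, q.eval t = ∑ i ∈ Finset.range (K + 1), q.coeff i * t ^ i := fun t =>
    eval_eq_sum_range' (by omega) t
  simp_rw [h]
  rw [intervalIntegral.integral_finsetSum fun i _ =>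
    (Continuous.intervalIntegrable (by fun_prop) _ _)]
  refine Finset.sum_congr rfl fun i _ => ?_
  rw [intervalIntegral.integral_const_mul, integral_pow]

lemma integral_eval_pos {q : ℝ[X]} (hq : q ≠ 0) {a b : ℝ} (hab : a < b)
    (h : ∀ t, a < t → t < b → 0 ≤ q.eval t) : 0 < ∫ t in a..b, q.eval t := by
  have hcl : Set.Icc a b ⊆ {t | 0 ≤ q.eval t} := by
    rw [← closure_Ioo hab.ne]
    exact closure_minimal (fun t ht => h t ht.1 ht.2)
      (isClosed_le continuous_const q.continuous)
  refine intervalIntegral.integral_pos hab q.continuous.continuousOn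
    (fun t ht => hcl (Set.Ioc_subset_Icc_self ht)) ?_
  obtain ⟨t, ht, htr⟩ := (Set.Ioo_infinite hab).exists_notMem_finset q.roots.toFinset
  refine ⟨t, Set.Ioo_subset_Icc_self ht, lt_of_le_of_ne (h t ht.1 ht.2) fun h0 => htr ?_⟩
  simp [hq, IsRoot, ← h0]

/-- If a polynomial of degree `K` separates `w` and `w'` in the sense of `exists_monic_sign_eq`, and
the first `K` power sums of `w` and `w'` agree, then the next power sums are comparable, and equal
only if `w = w'`. -/
lemma powerSum_compare {ι : Type*} [Fintype ι] {K : ℕ} {w w' : ι → ℝ} {q : ℝ[X]} (hq : q.Monic)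
    (hqK : q.natDegree = K) {s : ℝ} (hs : s ≠ 0)
    (h : ∀ j t, (w j < t → t < w' j → 0 ≤ s * q.eval t) ∧
      (w' j < t → t < w j → s * q.eval t ≤ 0))
    (hp : ∀ a, 1 ≤ a → a ≤ K → ∑ j, w' j ^ a = ∑ j, w j ^ a) :
    0 ≤ s * (∑ j, w' j ^ (K + 1) - ∑ j, w j ^ (K + 1)) ∧
      (∑ j, w' j ^ (K + 1) = ∑ j, w j ^ (K + 1) → w' = w) := by
  have hq0 : C s * q ≠ 0 := mul_ne_zero (C_ne_zero.2 hs) hq.ne_zero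
  have hpos : ∀ j, w' j ≠ w j → 0 < ∫ t in (w j)..(w' j), (C s * q).eval t := by
    intro j hj
    rcases lt_or_gt_of_ne hj with hlt | hlt
    · have := integral_eval_pos (neg_ne_zero.2 hq0) hlt fun t h1 h2 => by
        rw [eval_neg, eval_C_mul]
        exact neg_nonneg.2 ((h j t).2 h1 h2)
      rw [intervalIntegral.integral_symm]
      simpa only [eval_neg, intervalIntegral.integral_neg] using this
    · exact integral_eval_pos hq0 hlt fun t h1 h2 => by
        rw [eval_C_mul]
        exact (h j t).1 h1 h2
  have hnonneg : ∀ j, 0 ≤ ∫ t in (w j)..(w' j), (C s * q).eval t := by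
    intro j
    by_cases hj : w' j = w j
    · simp [hj]
    · exact (hpos j hj).le
  -- Every coefficient of q below the leading one multiplies a difference of equal power sums, so
  -- only the leading term survives.
  have hsum : ∑ j, ∫ t in (w j)..(w' j), (C s * q).eval t =
      s * (∑ j, w' j ^ (K + 1) - ∑ j, w j ^ (K + 1)) / (K + 1) := by
    simp_rw [eval_C_mul, intervalIntegral.integral_const_mul, integral_eval_eq_sum hqK]
    rw [← Finset.mul_sum, Finset.sum_comm, mul_div_assoc]
    congr 1
    rw [Finset.sum_range_succ, Finset.sum_eq_zero, zero_add]
    · rw [← hqK, hq.coeff_natDegree]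
      simp_rw [one_mul]
      rw [← Finset.sum_div, Finset.sum_sub_distrib]
    · intro i hi
      rw [Finset.mem_range] at hi
      rw [← Finset.mul_sum, ← Finset.sum_div, Finset.sum_sub_distrib, hp (i + 1) (by omega) hi]
      simp
  have hK : (0 : ℝ) < K + 1 := by positivity
  constructor
  · have := Finset.sum_nonneg fun j (_ : j ∈ Finset.univ) => hnonneg j
    rw [hsum] at this
    simpa [div_mul_cancel₀ _ hK.ne'] using mul_nonneg this hK.le
  · intro heq
    rw [heq, sub_self, mul_zero, zero_div] at hsum
    funext j
    by_contra hj
    exact (hpos j hj).ne' ((Finset.sum_eq_zero_iff_of_nonneg fun j _ => hnonneg j).1 hsum j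
      (Finset.mem_univ j))

/-! ### Signs of a polynomial and root counts. -/

/-- The number of real roots of `q` that exceed `t`, counted with multiplicity. -/
noncomputable def rootsAbove (q : ℝ[X]) (t : ℝ) : ℕ := (q.roots.filter (t < ·)).card

lemma rootsAbove_X_sub_C_mul {r : ℝ} {q : ℝ[X]} (hq : (X - C r) * q ≠ 0) (t : ℝ) :
    rootsAbove ((X - C r) * q) t = (if t < r then 1 else 0) + rootsAbove q t := by
  classical
  rw [rootsAbove, roots_mul hq, roots_X_sub_C, Multiset.filter_add, Multiset.card_add, rootsAbove,
    Multiset.filter_singleton]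
  split_ifs <;> simp

/-- With no root from t onwards, the sign at infinity persists down to t by the intermediate value
theorem. -/
lemma leadingCoeff_mul_eval_pos {q : ℝ[X]} (hq : q ≠ 0) {t : ℝ}
    (h : ∀ r, t ≤ r → ¬ q.IsRoot r) : 0 < q.leadingCoeff * q.eval t := by
  by_contra hcon
  set p : ℝ[X] := C q.leadingCoeff * q with hp
  have hlc : q.leadingCoeff ≠ 0 := leadingCoeff_ne_zero.2 hq
  have hpt : p.eval t ≤ 0 := by rw [hp, eval_C_mul]; exact not_lt.1 hcon
  have hplc : 0 < p.leadingCoeff := by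
    rw [hp, leadingCoeff_mul, leadingCoeff_C]
    exact mul_self_pos.2 hlc
  obtain ⟨u, htu, hu⟩ : ∃ u, t ≤ u ∧ 0 ≤ p.eval u := by
    rcases Nat.eq_zero_or_pos p.natDegree with h0 | h0
    · refine ⟨t, le_rfl, ?_⟩
      rw [eq_C_of_natDegree_eq_zero h0, eval_C]
      rw [leadingCoeff, h0] at hplc
      exact hplc.le
    · have := p.tendsto_atTop_of_leadingCoeff_nonneg (natDegree_pos_iff_degree_pos.1 h0) hplc.le
      obtain ⟨u, hu1, hu2⟩ := ((Filter.eventually_ge_atTop t).and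
        (this.eventually_ge_atTop 0)).exists
      exact ⟨u, hu1, hu2⟩
  obtain ⟨r, hr, hr0⟩ := intermediate_value_Icc htu p.continuous.continuousOn
    (show (0 : ℝ) ∈ Set.Icc _ _ from ⟨hpt, hu⟩)
  refine h r hr.1 ?_
  simp only [hp, eval_C_mul] at hr0
  exact (mul_eq_zero.1 hr0).resolve_left hlc

/-- Away from the roots, the sign of a polynomial is determined by its leading coefficient and the
number of roots to the right. -/
lemma sign_eval_of_not_isRoot (q : ℝ[X]) (t : ℝ) (ht : q.eval t ≠ 0) :
    0 < (-1) ^ rootsAbove q t * (q.leadingCoeff * q.eval t) := by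
  induction hn : q.natDegree using Nat.strong_induction_on generalizing q with
  | _ n ih =>
    have hq : q ≠ 0 := by rintro rfl; simp at ht
    by_cases h : ∃ r, t ≤ r ∧ q.IsRoot r
    · obtain ⟨r, hr, hroot⟩ := h
      obtain ⟨g, rfl⟩ := dvd_iff_isRoot.2 hroot
      have hg : g ≠ 0 := right_ne_zero_of_mul hq
      have htr : t < r := lt_of_le_of_ne hr (by rintro rfl; simp at ht)
      rw [eval_mul] at ht
      have hdeg : g.natDegree < n := by
        rw [← hn, natDegree_mul (X_sub_C_ne_zero r) hg, natDegree_X_sub_C]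
        omega
      have h1 := ih _ hdeg g (right_ne_zero_of_mul ht) rfl
      rw [rootsAbove_X_sub_C_mul hq, if_pos htr, leadingCoeff_mul, leadingCoeff_X_sub_C, eval_mul,
        eval_sub, eval_X, eval_C]
      have := mul_pos (sub_pos.2 htr) h1
      calc (0 : ℝ) < _ := this
        _ = _ := by ring
    · push Not at h
      have : rootsAbove q t = 0 := by
        rw [rootsAbove, Multiset.card_eq_zero, Multiset.filter_eq_nil]
        intro r hr htr
        exact h r htr.le (isRoot_of_mem_roots hr)
      rw [this, pow_zero, one_mul]
      exact leadingCoeff_mul_eval_pos hq h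

/-- At a simple root, the sign of the derivative of a polynomial is determined by its leading
coefficient and the number of roots to the right. -/
lemma sign_derivative_of_isRoot {q : ℝ[X]} {t : ℝ} (ht : q.IsRoot t)
    (ht' : q.derivative.eval t ≠ 0) :
    0 < (-1) ^ rootsAbove q t * (q.leadingCoeff * q.derivative.eval t) := by
  obtain ⟨g, rfl⟩ := dvd_iff_isRoot.2 ht
  have hd : ((X - C t) * g).derivative.eval t = g.eval t := by simp
  rw [hd] at ht' ⊢
  have hq : (X - C t) * g ≠ 0 := by
    refine mul_ne_zero (X_sub_C_ne_zero t) ?_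
    rintro rfl
    simp at ht'
  rw [rootsAbove_X_sub_C_mul hq, if_neg (lt_irrefl t), zero_add, leadingCoeff_mul,
    leadingCoeff_X_sub_C, one_mul]
  exact sign_eval_of_not_isRoot g t ht'

/-- The roots above u and the copies of u are disjoint parts of the root multiset. -/
lemma rootsAbove_add_rootMultiplicity_le (q : ℝ[X]) (u : ℝ) :
    rootsAbove q u + q.rootMultiplicity u ≤ q.natDegree := by
  classical
  refine le_trans ?_ (card_roots' q)
  rw [rootsAbove, ← count_roots, ← Multiset.card_replicate (q.roots.count u) u,
    ← Multiset.card_add]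
  refine Multiset.card_le_card (Multiset.le_iff_count.2 fun r => ?_)
  rw [Multiset.count_add, Multiset.count_filter, Multiset.count_replicate]
  split_ifs with h1 h2 h3
  all_goals first | omega | (exfalso; linarith) | (subst_vars; simp)

lemma rootsAbove_add_rootMultiplicity_le_of_lt (q : ℝ[X]) {t u : ℝ} (htu : t < u) :
    rootsAbove q u + q.rootMultiplicity u ≤ rootsAbove q t := by
  classical
  rw [rootsAbove, rootsAbove, ← count_roots, ← Multiset.card_replicate (q.roots.count u) u,
    ← Multiset.card_add]
  refine Multiset.card_le_card (Multiset.le_iff_count.2 fun r => ?_)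
  rw [Multiset.count_add, Multiset.count_filter, Multiset.count_filter, Multiset.count_replicate]
  split_ifs with h1 h2 h3 h3 h4 h5 h6
  all_goals first | omega | (exfalso; linarith) | (subst_vars; simp_all; try linarith)

lemma neg_one_pow_mul_pos {R : ℕ} {a : ℝ} (h : 0 < (-1 : ℝ) ^ R * a) :
    (0 < a ∧ R % 2 = 0) ∨ (a < 0 ∧ R % 2 = 1) := by
  rcases Nat.even_or_odd R with hR | hR
  · rw [hR.neg_one_pow, one_mul] at h
    exact Or.inl ⟨h, Nat.even_iff.1 hR⟩
  · rw [hR.neg_one_pow] at h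
    exact Or.inr ⟨by linarith, Nat.odd_iff.1 hR⟩

/-! ### From root counts to block structures. -/

/-- The slowest walk along the sequence `W` that starts in `s`, may stay in place only at states
with the parity of `e` and while `W` is constant, and otherwise advances by one. -/
noncomputable def slowWalk (W : ℕ → ℝ) (e s : ℕ) : ℕ → ℕ
  | 0 => s
  | i + 1 => open Classical in
    if W (i + 1) = W i ∧ slowWalk W e s i % 2 = e % 2 then slowWalk W e s i
    else slowWalk W e s i + 1

lemma slowWalk_succ (W : ℕ → ℝ) (e s i : ℕ) :
    (slowWalk W e s (i + 1) = slowWalk W e s i ∧ W (i + 1) = W i ∧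
      slowWalk W e s i % 2 = e % 2) ∨
    (slowWalk W e s (i + 1) = slowWalk W e s i + 1 ∧
      (W (i + 1) = W i → slowWalk W e s i % 2 ≠ e % 2)) := by
  classical
  by_cases h : W (i + 1) = W i ∧ slowWalk W e s i % 2 = e % 2
  · exact Or.inl ⟨by rw [slowWalk, if_pos h], h⟩
  · exact Or.inr ⟨by rw [slowWalk, if_neg h], fun h1 h2 => h ⟨h1, h2⟩⟩

/-- If the positive terms of a sequence `W` of length `n` are roots of a polynomial `q` of degree at
most `K` with nonnegative derivative at repeated terms, then for a suitable parity the slow walk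
along `W` does not exceed `K`. -/
lemma exists_slowWalk_le {n K : ℕ} {W : ℕ → ℝ} (hW : Monotone W) (hW0 : ∀ i, 0 ≤ W i)
    {q : ℝ[X]} (hq : q ≠ 0) (hqK : q.natDegree ≤ K)
    (hroot : ∀ i, 0 < W i → q.IsRoot (W i)) (hzero : W 0 = 0 → 0 ≤ q.eval 0)
    (hrep : ∀ i, i + 1 < n → W (i + 1) = W i → 0 < W i → 0 ≤ q.derivative.eval (W i)) :
    ∃ e s, s ≤ 1 ∧ (s = 0 → e % 2 = 0 ∧ W 0 = 0) ∧ ∀ i < n, slowWalk W e s i ≤ K := by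
  classical
  -- At a simple root with positive derivative and R roots above it, (-1)^R is the sign of the
  -- leading coefficient. A state c with c + R = K thus has the parity of K or the opposite one
  -- according to that sign; this parity is e.
  obtain ⟨e, he⟩ : ∃ e : ℕ, (0 < q.leadingCoeff → e % 2 = K % 2) ∧
      (q.leadingCoeff < 0 → e % 2 ≠ K % 2) := by
    by_cases h : 0 < q.leadingCoeff
    · exact ⟨K, fun _ => rfl, fun h' => absurd h h'.not_gt⟩
    · exact ⟨K + 1, fun h' => absurd h' h, fun _ => by omega⟩
  have hpar : ∀ i, i + 1 < n → W (i + 1) = W i → 0 < W i → q.rootMultiplicity (W i) = 1 →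
      ∀ c, c + rootsAbove q (W i) = K → c % 2 = e % 2 := by
    intro i hin hi hpos hmult c hc
    have hd : q.derivative.eval (W i) ≠ 0 := fun h0 => by
      have := (one_lt_rootMultiplicity_iff_isRoot hq).2 ⟨hroot i hpos, h0⟩
      omega
    have h1 := sign_derivative_of_isRoot (hroot i hpos) hd
    have h2 : 0 < q.derivative.eval (W i) := lt_of_le_of_ne (hrep i hin hi hpos) hd.symm
    rcases neg_one_pow_mul_pos h1 with ⟨h3, h4⟩ | ⟨h3, h4⟩
    · have := he.1 (pos_of_mul_pos_left h3 h2.le)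
      omega
    · have := he.2 (neg_of_mul_neg_left h3 h2.le)
      omega
  have hmultpos : ∀ i, 0 < W i → 1 ≤ q.rootMultiplicity (W i) := fun i hi =>
    (rootMultiplicity_pos hq).2 (hroot i hi)
  set s : ℕ := if W 0 = 0 ∧ e % 2 = 0 then 0 else 1 with hs
  -- Invariant: the current block index plus the number of roots still above is at most K. With
  -- equality there is no spare block, and then the parity must already permit staying at a repeated
  -- term; with a spare block, one advance reaches the right parity.
  have key : ∀ i < n, slowWalk W e s i + rootsAbove q (W i) ≤ K ∧
      (i + 1 < n → W (i + 1) = W i → slowWalk W e s i + rootsAbove q (W i) = K →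
        slowWalk W e s i % 2 = e % 2) := by
    intro i
    induction i with
    | zero =>
      intro _
      have hR := (rootsAbove_add_rootMultiplicity_le q (W 0)).trans hqK
      have hsw : slowWalk W e s 0 = s := by rw [slowWalk]
      rw [hsw]
      rcases (hW0 0).eq_or_lt with h0 | h0
      · by_cases hee : e % 2 = 0
        · rw [hs, if_pos ⟨h0.symm, hee⟩]
          exact ⟨by omega, fun _ _ _ => by omega⟩
        · rw [hs, if_neg fun h => hee h.2]
          refine ⟨?_, fun _ _ _ => by omega⟩
          -- Otherwise all K roots are positive and q(0) > 0, and the sign rule makes e even.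
          by_contra hcon
          have hRK : rootsAbove q (W 0) = K := by omega
          have hm : q.rootMultiplicity (W 0) = 0 := by omega
          rw [← h0] at hRK hm
          have h00 : q.eval 0 ≠ 0 := fun h => by
            have := (rootMultiplicity_pos hq).2 h
            omega
          have h1 := sign_eval_of_not_isRoot q 0 h00
          have h2 : 0 < q.eval 0 := lt_of_le_of_ne (hzero h0.symm) h00.symm
          rcases neg_one_pow_mul_pos h1 with ⟨h3, h4⟩ | ⟨h3, h4⟩
          · have := he.1 (pos_of_mul_pos_left h3 h2.le)
            omega
          · have := he.2 (neg_of_mul_neg_left h3 h2.le)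
            omega
      · rw [hs, if_neg fun h => h0.ne' h.1]
        have := hmultpos 0 h0
        refine ⟨by omega, fun hn h1 h2 => hpar 0 hn h1 h0 (by omega) 1 h2⟩
    | succ i ih =>
      intro hi
      obtain ⟨ih1, ih2⟩ := ih (by omega)
      have hstep := slowWalk_succ W e s i
      rcases (hW (Nat.le_succ i)).eq_or_lt with heq | hlt
      · have heq' : W (i + 1) = W i := heq.symm
        have h3 := ih2 hi heq'
        rw [heq']
        rcases hstep with ⟨h1, h2, h4⟩ | ⟨h1, h2⟩
        · exact ⟨by omega, fun _ _ _ => by omega⟩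
        · have := h2 heq'
          exact ⟨by omega, fun _ _ _ => by omega⟩
      -- A larger term is a root no longer counted above, which pays for the advance; a multiple
      -- root leaves a spare block, so equality occurs only at simple roots.
      · have hpos : 0 < W (i + 1) := (hW0 i).trans_lt hlt
        have hR := rootsAbove_add_rootMultiplicity_le_of_lt q (show W i < W (i + 1) from hlt)
        have hm := hmultpos (i + 1) hpos
        rcases hstep with ⟨_, h2, _⟩ | ⟨h1, _⟩
        · exact absurd h2 hlt.ne'
        · refine ⟨by omega, fun hn h3 h4 => hpar (i + 1) hn h3 hpos (by omega) _ h4⟩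
  refine ⟨e, s, ?_, ?_, fun i hi => by have := (key i hi).1; omega⟩
  · rw [hs]; split_ifs <;> omega
  · intro h
    by_contra hcon
    rw [hs, if_neg fun h' => hcon ⟨h'.2, h'.1⟩] at h
    omega

/-- Under the assumptions of `exists_slowWalk_le`, the sequence `W` admits a block structure with
last block `K`. -/
lemma exists_blockIndex {n K : ℕ} (hKn : K ≤ n) (hK : 1 ≤ K) {W : ℕ → ℝ} (hW : Monotone W)
    (hW0 : ∀ i, 0 ≤ W i) {q : ℝ[X]} (hq : q ≠ 0) (hqK : q.natDegree ≤ K)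
    (hroot : ∀ i, 0 < W i → q.IsRoot (W i)) (hzero : W 0 = 0 → 0 ≤ q.eval 0)
    (hrep : ∀ i, i + 1 < n → W (i + 1) = W i → 0 < W i → 0 ≤ q.derivative.eval (W i)) :
    ∃ (e : ℕ) (β : ℕ → ℕ), β 0 ≤ 1 ∧ (e % 2 = 1 → 1 ≤ β 0) ∧ β (n - 1) = K ∧
      (∀ i, (β (i + 1) = β i ∧ W (i + 1) = W i ∧ β i % 2 = e % 2) ∨ β (i + 1) = β i + 1) ∧
      ∀ i, β i = 0 → W i = 0 := by
  obtain ⟨e, s, hs1, hs0, hle⟩ := exists_slowWalk_le hW hW0 hq hqK hroot hzero hrep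
  have hstart : slowWalk W e s 0 = s := by rw [slowWalk]
  -- The slow walk may end below K. Its maximum with the line of slope one ending at K in position n
  -- - 1 uses all blocks; once the line takes over, each step advances. The bound K ≤ n keeps the
  -- start at most 1.
  refine ⟨e, fun i => max (slowWalk W e s i) (K + i + 1 - n), ?_, ?_, ?_, ?_, ?_⟩
  · simp only [hstart]; omega
  · intro he
    simp only [hstart]
    have : s ≠ 0 := fun h => by have := (hs0 h).1; omega
    omega
  · have := hle (n - 1) (by omega)
    simp only
    omega
  · intro i
    simp only
    rcases slowWalk_succ W e s i with ⟨h1, h2, h3⟩ | ⟨h1, _⟩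
    · rw [h1]
      by_cases hi : slowWalk W e s i < K + (i + 1) + 1 - n
      · right; omega
      · left
        refine ⟨by omega, h2, ?_⟩
        rw [max_eq_left (by omega : K + i + 1 - n ≤ slowWalk W e s i)]
        exact h3
    · right; omega
  · intro i hi
    have h0 : slowWalk W e s i = 0 :=
      Nat.le_zero.1 ((le_max_left _ (K + i + 1 - n)).trans_eq hi)
    have hz : ∀ i, slowWalk W e s i = 0 → W i = 0 := by
      intro i
      induction i with
      | zero =>
        intro h
        exact (hs0 (by omega)).2
      | succ i ih =>
        intro h
        rcases slowWalk_succ W e s i with ⟨h1, h2, h3⟩ | ⟨h1, _⟩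
        · rw [h2]; exact ih (by omega)
        · omega
    exact hz i h0

/-! ### Block vectors and their multiplicities. -/

variable {n k : ℕ}

lemma monotone_cons_zero {x : Fin (k + 1) → ℝ} (hx0 : ∀ i, 0 ≤ x i) (hx : Monotone x) :
    Monotone (Fin.cons 0 x : Fin (k + 2) → ℝ) := by
  intro i
  refine Fin.cases (fun j => ?_) (fun i j => ?_) i
  · refine Fin.cases (fun _ => le_rfl) (fun j _ => ?_) j
    simpa using hx0 j
  · refine Fin.cases (fun h => ?_) (fun j h => ?_) j
    · exact absurd h (by simp)
    · simpa using hx (Fin.succ_le_succ_iff.1 h)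

lemma sum_Iic_le_sum_Iio (m : Fin (k + 2) → ℕ) {i i' : Fin (k + 2)} (h : i < i') :
    ∑ l ∈ Finset.Iic i, m l ≤ ∑ l ∈ Finset.Iio i', m l :=
  Finset.sum_le_sum_of_subset fun l hl => by
    rw [Finset.mem_Iic] at hl
    exact Finset.mem_Iio.2 (hl.trans_lt h)

/-- A multiplicity vector of total `n` assigns to each of the `n` positions its block. -/
lemma exists_blockMap (m : Fin (k + 2) → ℕ) (hm : ∑ i, m i = n) :
    ∃ β : Fin n → Fin (k + 2), Monotone β ∧
      (∀ i, (Finset.univ.filter fun j => β j = i).card = m i) ∧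
      ∀ x w, IsBlockVector m x w ↔ ∀ j, w j = (Fin.cons 0 x : Fin (k + 2) → ℝ) (β j) := by
  classical
  have hex : ∀ j : Fin n, ∃ i : Fin (k + 2),
      ∑ l ∈ Finset.Iio i, m l ≤ (j : ℕ) ∧ (j : ℕ) < ∑ l ∈ Finset.Iic i, m l := by
    intro j
    have key : ∀ i : Fin (k + 2), (j : ℕ) < ∑ l ∈ Finset.Iic i, m l → ∃ i : Fin (k + 2),
        ∑ l ∈ Finset.Iio i, m l ≤ (j : ℕ) ∧ (j : ℕ) < ∑ l ∈ Finset.Iic i, m l := by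
      intro i
      induction i using Fin.induction with
      | zero =>
        intro h
        refine ⟨0, ?_, h⟩
        rw [Finset.sum_eq_zero fun l hl => absurd (Finset.mem_Iio.1 hl) (Fin.not_lt_zero l)]
        exact Nat.zero_le _
      | succ i ih =>
        intro h
        by_cases h' : (j : ℕ) < ∑ l ∈ Finset.Iic i.castSucc, m l
        · exact ih h'
        · refine ⟨i.succ, ?_, h⟩
          have : Finset.Iio i.succ = Finset.Iic i.castSucc := by
            ext l
            rw [Finset.mem_Iio, Finset.mem_Iic, Fin.lt_def, Fin.le_def, Fin.val_succ,
              Fin.val_castSucc, Nat.lt_succ_iff]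
          rw [this]
          exact not_lt.1 h'
    refine key (Fin.last _) ?_
    have : Finset.Iic (Fin.last (k + 1)) = Finset.univ := by
      ext l; simp [Fin.le_last]
    rw [this, hm]
    exact j.2
  choose β hβ1 hβ2 using hex
  have huniq : ∀ (j : Fin n) (i : Fin (k + 2)), ∑ l ∈ Finset.Iio i, m l ≤ (j : ℕ) →
      (j : ℕ) < ∑ l ∈ Finset.Iic i, m l → β j = i := by
    intro j i h1 h2
    rcases lt_trichotomy (β j) i with h | h | h
    · have := sum_Iic_le_sum_Iio m h
      have := hβ2 j
      omega
    · exact h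
    · have := sum_Iic_le_sum_Iio m h
      have := hβ1 j
      omega
  refine ⟨β, ?_, ?_, ?_⟩
  · intro j j' hjj
    by_contra hcon
    have h1 := sum_Iic_le_sum_Iio m (not_le.1 hcon)
    have h2 := hβ1 j
    have h3 := hβ2 j'
    rw [Fin.le_def] at hjj
    omega
  · intro i
    have himage : (Finset.univ.filter fun j => β j = i).image Fin.val =
        Finset.Ico (∑ l ∈ Finset.Iio i, m l) (∑ l ∈ Finset.Iic i, m l) := by
      ext a
      simp only [Finset.mem_image, Finset.mem_filter, Finset.mem_univ, true_and, Finset.mem_Ico]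
      constructor
      · rintro ⟨j, rfl, rfl⟩
        exact ⟨hβ1 j, hβ2 j⟩
      · rintro ⟨h1, h2⟩
        have h3 : ∑ l ∈ Finset.Iic i, m l ≤ n := by
          rw [← hm]
          exact Finset.sum_le_sum_of_subset (Finset.subset_univ _)
        exact ⟨⟨a, by omega⟩, huniq _ _ h1 h2, rfl⟩
    have h1 := Finset.card_image_of_injective (Finset.univ.filter fun j => β j = i)
      Fin.val_injective
    rw [himage, Nat.card_Ico] at h1
    have h2 : Finset.Iic i = insert i (Finset.Iio i) := by
      ext l
      rw [Finset.mem_Iic, Finset.mem_insert, Finset.mem_Iio, le_iff_eq_or_lt]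
    rw [h2, Finset.sum_insert (by simp)] at h1
    omega
  · intro x w
    constructor
    · exact fun h j => h (β j) j (hβ1 j) (hβ2 j)
    · intro h i j h1 h2
      rw [h j, huniq j i h1 h2]

/-- Converse direction to `exists_blockMap`: the fibres of a monotone map are consecutive intervals,
so their cardinalities determine it. -/
lemma isBlockVector_of_monotone {β : Fin n → Fin (k + 2)} (hβ : Monotone β)
    (x : Fin (k + 1) → ℝ) :
    IsBlockVector (fun i => (Finset.univ.filter fun j => β j = i).card) x
      fun j => (Fin.cons 0 x : Fin (k + 2) → ℝ) (β j) := by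
  classical
  intro i j h1 h2
  have hsum : ∀ s : Finset (Fin (k + 2)),
      ∑ l ∈ s, (Finset.univ.filter fun j => β j = l).card =
        (Finset.univ.filter fun j => β j ∈ s).card := by
    intro s
    rw [Finset.card_eq_sum_card_fiberwise (f := β) (t := s) (fun j hj => by simpa using hj)]
    refine Finset.sum_congr rfl fun l hl => ?_
    rw [Finset.filter_filter]
    congr 1
    ext j
    simp only [Finset.mem_filter, Finset.mem_univ, true_and]
    constructor
    · rintro rfl; exact ⟨hl, rfl⟩
    · exact fun h => h.2
  rw [hsum] at h1 h2
  suffices β j = i by simp only [this]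
  rcases lt_trichotomy (β j) i with h | h | h
  · have hsub : Finset.Iic j ⊆ Finset.univ.filter fun j => β j ∈ Finset.Iio i := by
      intro l hl
      simp only [Finset.mem_filter, Finset.mem_univ, true_and, Finset.mem_Iio]
      exact (hβ (Finset.mem_Iic.1 hl)).trans_lt h
    have := Finset.card_le_card hsub
    rw [Fin.card_Iic] at this
    omega
  · exact h
  · have hsub : (Finset.univ.filter fun j => β j ∈ Finset.Iic i) ⊆ Finset.Iio j := by
      intro l hl
      simp only [Finset.mem_filter, Finset.mem_univ, true_and, Finset.mem_Iic] at hl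
      rw [Finset.mem_Iio]
      by_contra hcon
      exact absurd (hβ (not_lt.1 hcon)) (not_le.2 (hl.trans_lt h))
    have := Finset.card_le_card hsub
    rw [Fin.card_Iio] at this
    omega

/-- The two parity patterns in a uniform way: a block with positive index may be repeated only if
its index has the parity of `e`, and the zero block is empty if `e` is odd. -/
def IsAlternating (e : ℕ) (m : Fin (k + 2) → ℕ) : Prop :=
  (e % 2 = 1 → m 0 = 0) ∧
    ∀ i : Fin (k + 1), 1 ≤ m i.succ ∧ ((i.succ : ℕ) % 2 ≠ e % 2 → m i.succ = 1)

lemma exists_isAlternating_iff (m : Fin (k + 2) → ℕ) :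
    (∃ e, IsAlternating e m) ↔ IsFirstPattern m ∨ IsSecondPattern m := by
  constructor
  · rintro ⟨e, h0, h⟩
    rcases Nat.mod_two_eq_zero_or_one e with he | he
    · refine Or.inl fun i => ⟨fun hi => (h i).2 ?_, fun _ => (h i).1⟩
      rw [Nat.odd_iff.1 hi]; omega
    · refine Or.inr ⟨h0 he, fun i => ⟨fun hi => (h i).2 ?_, fun _ => (h i).1⟩⟩
      rw [Nat.even_iff.1 hi]; omega
  · rintro (h | ⟨h0, h⟩)
    · refine ⟨0, fun h => absurd h (by omega), fun i => ⟨?_, fun hi => (h i).1 ?_⟩⟩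
      · rcases Nat.even_or_odd (i.succ : ℕ) with hi | hi
        · exact (h i).2 hi
        · exact ((h i).1 hi).ge
      · rw [Nat.odd_iff]; omega
    · refine ⟨1, fun _ => h0, fun i => ⟨?_, fun hi => (h i).1 ?_⟩⟩
      · rcases Nat.even_or_odd (i.succ : ℕ) with hi | hi
        · exact ((h i).1 hi).ge
        · exact (h i).2 hi
      · rw [Nat.even_iff]; omega

/-! ### Extremality of alternating vectors and parametrization of the components. -/

/-- Among the nonnegative vectors with prescribed power sums of degree at most `d - 1`, a vector
with an alternating block structure is the unique extremal point of the `d`-th power sum. -/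
lemma powerSum_compare_of_isBlockVector {m : Fin (k + 2) → ℕ} (hm : ∑ i, m i = n) {e : ℕ}
    (he : IsAlternating e m) {x : Fin (k + 1) → ℝ} (hx0 : ∀ i, 0 ≤ x i) (hx : Monotone x)
    {w w' : Fin n → ℝ} (hw : IsBlockVector m x w) (hw' : Monotone w') (hw'0 : ∀ j, 0 ≤ w' j)
    (hp : ∀ a, 1 ≤ a → a ≤ k + 1 → ∑ j, w' j ^ a = ∑ j, w j ^ a) :
    0 ≤ (-1) ^ (k + 1 + e) * (∑ j, w' j ^ (k + 2) - ∑ j, w j ^ (k + 2)) ∧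
      (∑ j, w' j ^ (k + 2) = ∑ j, w j ^ (k + 2) → w' = w) := by
  classical
  obtain ⟨β, hβ, hcard, hblock⟩ := exists_blockMap m hm
  have hwβ := (hblock x w).1 hw
  set y : Fin (k + 2) → ℝ := Fin.cons 0 x with hy
  have hymono : Monotone y := monotone_cons_zero hx0 hx
  -- Beyond the last block the values are continued by an upper bound for all coordinates of w', as
  -- the clamping at block K needs a right neighbour.
  set x' : ℕ → ℝ := fun b => if h : b < k + 2 then y ⟨b, h⟩
    else max (y (Fin.last _)) (∑ j, w' j) with hx'
  have hx'β : ∀ j, x' (β j) = w j := fun j => by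
    rw [hwβ j, hx']
    simp only [(β j).2, dif_pos]
  have hx'mono : Monotone x' := by
    intro a b hab
    simp only [hx']
    split_ifs with h1 h2 h2
    · exact hymono hab
    · exact (hymono (Fin.le_last _)).trans (le_max_left _ _)
    · omega
    · exact le_rfl
  have hx'0 : x' 0 = 0 := by
    rw [hx']
    simp [hy]
  -- For a single-position block this is w' at its only position; the default 0 plays no role there.
  set v : ℕ → ℝ := fun b => if h : ∃ s, (β s : ℕ) = b then w' h.choose else 0 with hv
  have hpivot : ∀ b, 1 ≤ b → b ≤ k + 1 → b % 2 ≠ e % 2 →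
      (∀ j, (β j : ℕ) ≤ b → w' j ≤ v b) ∧ ∀ j, b ≤ (β j : ℕ) → v b ≤ w' j := by
    intro b hb1 hbK hbe
    obtain ⟨i, rfl⟩ : ∃ i : Fin (k + 1), b = (i.succ : Fin (k + 2)) :=
      ⟨⟨b - 1, by omega⟩, by simp; omega⟩
    have h1 := (he.2 i).2 hbe
    rw [← hcard] at h1
    obtain ⟨s, hs⟩ := Finset.card_eq_one.1 h1
    have hs' : ∀ j, β j = i.succ ↔ j = s := fun j => by
      have : j ∈ Finset.univ.filter (fun j => β j = i.succ) ↔ j ∈ ({s} : Finset _) := by rw [hs]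
      simpa using this
    have hβs := (hs' s).2 rfl
    have hex : ∃ s, (β s : ℕ) = (i.succ : Fin (k + 2)) := ⟨s, by rw [hβs]⟩
    have hvs : v (i.succ : Fin (k + 2)) = w' s := by
      rw [hv]
      simp only [hex, dif_pos]
      rw [(hs' _).1 (Fin.ext hex.choose_spec)]
    rw [hvs]
    constructor
    · intro j hj
      refine hw' (not_lt.1 fun hlt => hlt.ne' ((hs' j).1 (le_antisymm hj ?_)))
      rw [← hβs]
      exact hβ hlt.le
    · intro j hj
      refine hw' (not_lt.1 fun hlt => hlt.ne ((hs' j).1 (le_antisymm ?_ hj)))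
      rw [← hβs]
      exact hβ hlt.le
  have hodd : e % 2 = 1 → ∀ j, 1 ≤ (β j : ℕ) := by
    intro heo j
    by_contra hcon
    have h0 : β j = 0 := Fin.ext (by simpa using hcon)
    have h1 := hcard 0
    rw [he.1 heo, Finset.card_eq_zero] at h1
    exact Finset.notMem_empty j (h1 ▸ Finset.mem_filter.2 ⟨Finset.mem_univ _, h0⟩)
  have htop : ∀ j, w' j ≤ x' (k + 1 + 1) := by
    intro j
    rw [hx']
    simp only [lt_irrefl, dif_neg, not_false_eq_true]
    exact (Finset.single_le_sum (fun j _ => hw'0 j) (Finset.mem_univ j)).trans (le_max_right _ _)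
  obtain ⟨q, hq, hqK, hsign⟩ := exists_monic_sign_eq (k + 1) e (fun j => (β j : ℕ))
    (fun j => Nat.lt_succ_iff.1 (β j).2) x' v hx'mono hx'0 w' hw'0 hpivot hodd htop
  simp only [hx'β] at hsign
  exact powerSum_compare hq hqK (pow_ne_zero _ (by norm_num)) hsign hp

lemma reducedMap_apply (w : Fin n → ℝ) (j : Fin (k + 1)) :
    reducedMap n k w j = ∑ i, w i ^ ((j : ℕ) + 2) := by
  simp [reducedMap, Fin.tail, vandermondeMap, add_assoc]

lemma continuous_reducedMap : Continuous (reducedMap n k) := by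
  refine continuous_pi fun j => ?_
  simp_rw [reducedMap_apply]
  fun_prop

lemma isCompact_vandermondeCell : IsCompact (vandermondeCell n k) :=
  (isCompact_stdSimplex ℝ (Fin n)).image continuous_reducedMap

/-- The power sums do not depend on the order of the coordinates. -/
lemma exists_monotone_reducedMap_eq {w : Fin n → ℝ} (hw : w ∈ stdSimplex ℝ (Fin n)) :
    ∃ σ : Equiv.Perm (Fin n), Monotone (w ∘ σ) ∧ w ∘ σ ∈ stdSimplex ℝ (Fin n) ∧
      reducedMap n k (w ∘ σ) = reducedMap n k w := by
  refine ⟨Tuple.sort w, Tuple.monotone_sort w, ⟨fun i => hw.1 _, ?_⟩, ?_⟩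
  · rw [← hw.2]
    exact Equiv.sum_comp (Tuple.sort w) w
  · funext j
    rw [reducedMap_apply, reducedMap_apply]
    exact Equiv.sum_comp (Tuple.sort w) fun i => w i ^ ((j : ℕ) + 2)

lemma boundaryParam_eq {m : Fin (k + 2) → ℕ} (hm : m (Fin.last (k + 1)) ≠ 0)
    {x : Fin (k + 1) → ℝ} (hx : ∑ i, (m i.succ : ℝ) * x i = 1) (j : Fin (k + 1)) :
    boundaryParam m x j = ∑ i, (m i.succ : ℝ) * x i ^ ((j : ℕ) + 2) := by
  have hm' : (m (Fin.last (k + 1)) : ℝ) ≠ 0 := Nat.cast_ne_zero.2 hm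
  rw [Fin.sum_univ_castSucc, Fin.succ_last] at hx
  rw [boundaryParam, Fin.sum_univ_castSucc, Fin.succ_last]
  congr 3
  simp_rw [div_mul_eq_mul_div]
  rw [← Finset.sum_div, ← sub_div, div_eq_iff hm']
  linarith

lemma sum_pow_of_isBlockVector {m : Fin (k + 2) → ℕ} (hm : ∑ i, m i = n)
    {x : Fin (k + 1) → ℝ} {w : Fin n → ℝ} (hw : IsBlockVector m x w) {a : ℕ} (ha : a ≠ 0) :
    ∑ j, w j ^ a = ∑ i, (m i.succ : ℝ) * x i ^ a := by
  obtain ⟨β, -, hcard, hblock⟩ := exists_blockMap m hm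
  have hwβ := (hblock x w).1 hw
  simp_rw [hwβ]
  have h := Finset.sum_fiberwise' Finset.univ β fun i => (Fin.cons 0 x : Fin (k + 2) → ℝ) i ^ a
  rw [← h]
  simp_rw [Finset.sum_const, hcard, nsmul_eq_mul]
  rw [Fin.sum_univ_succ]
  simp [ha]

lemma exists_isBlockVector {m : Fin (k + 2) → ℕ} (hm : ∑ i, m i = n)
    {x : Fin (k + 1) → ℝ} (hx0 : ∀ i, 0 ≤ x i) (hx : Monotone x) :
    ∃ w : Fin n → ℝ, IsBlockVector m x w ∧ Monotone w ∧ ∀ j, 0 ≤ w j := by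
  obtain ⟨β, hβ, -, hblock⟩ := exists_blockMap m hm
  have hmono := monotone_cons_zero hx0 hx
  refine ⟨_, (hblock x _).2 fun j => rfl, hmono.comp hβ, fun j => ?_⟩
  have := hmono (Fin.zero_le (β j))
  rwa [Fin.cons_zero] at this

lemma reducedMap_eq_boundaryParam {m : Fin (k + 2) → ℕ} (hm : ∑ i, m i = n)
    (hlast : m (Fin.last (k + 1)) ≠ 0) {x : Fin (k + 1) → ℝ} (hx : x ∈ paramDomain m)
    {w : Fin n → ℝ} (hw : IsBlockVector m x w) :
    reducedMap n k w = boundaryParam m x := by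
  funext j
  rw [reducedMap_apply, boundaryParam_eq hlast hx.2.2, sum_pow_of_isBlockVector hm hw (by omega)]

lemma IsAlternating.last_ne_zero {e : ℕ} {m : Fin (k + 2) → ℕ} (he : IsAlternating e m) :
    m (Fin.last (k + 1)) ≠ 0 :=
  Nat.one_le_iff_ne_zero.1 (he.2 (Fin.last k)).1

lemma isBlockVector_injective {m : Fin (k + 2) → ℕ} (hm : ∑ i, m i = n)
    (hpos : ∀ i : Fin (k + 1), 1 ≤ m i.succ) {x x' : Fin (k + 1) → ℝ} {w : Fin n → ℝ}
    (hx : IsBlockVector m x w) (hx' : IsBlockVector m x' w) : x = x' := by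
  obtain ⟨β, -, hcard, hblock⟩ := exists_blockMap m hm
  funext i
  have h1 := hpos i
  rw [← hcard, Nat.succ_le_iff, Finset.card_pos] at h1
  obtain ⟨j, hj⟩ := h1
  have hj' := (Finset.mem_filter.1 hj).2
  have h2 := (hblock x w).1 hx j
  have h3 := (hblock x' w).1 hx' j
  rw [hj', Fin.cons_succ] at h2 h3
  rw [← h2, h3]

/-- Injectivity is the equality case of the extremality: two parameters with the same image give
block vectors with the same p_1, …, p_d. -/
lemma bijOn_boundaryParam {m : Fin (k + 2) → ℕ} (hm : ∑ i, m i = n) {e : ℕ}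
    (he : IsAlternating e m) :
    Set.BijOn (boundaryParam m) (paramDomain m) (boundaryComponent n m) := by
  refine ⟨?_, ?_, ?_⟩
  · intro x hx
    obtain ⟨w, hw, -, hw0⟩ := exists_isBlockVector hm hx.1 hx.2.1
    refine ⟨w, ⟨⟨hw0, ?_⟩, x, hx.1, hx.2.1, hw⟩,
      reducedMap_eq_boundaryParam hm he.last_ne_zero hx hw⟩
    have := sum_pow_of_isBlockVector hm hw one_ne_zero
    simp only [pow_one] at this
    rw [this, hx.2.2]
  · intro x hx x' hx' heq
    obtain ⟨w, hw, hwmono, hw0⟩ := exists_isBlockVector hm hx.1 hx.2.1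
    obtain ⟨w', hw', hwmono', hw0'⟩ := exists_isBlockVector hm hx'.1 hx'.2.1
    have hp : ∀ a, 1 ≤ a → a ≤ k + 2 → ∑ j, w' j ^ a = ∑ j, w j ^ a := by
      intro a ha1 hak
      rw [sum_pow_of_isBlockVector hm hw (by omega), sum_pow_of_isBlockVector hm hw' (by omega)]
      rcases ha1.eq_or_lt with rfl | ha
      · simp only [pow_one]
        rw [hx.2.2, hx'.2.2]
      · have h := congrFun heq ⟨a - 2, by omega⟩
        rw [boundaryParam_eq he.last_ne_zero hx.2.2,
          boundaryParam_eq he.last_ne_zero hx'.2.2] at h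
        simp only [show a - 2 + 2 = a by omega] at h
        exact h.symm
    have hww := (powerSum_compare_of_isBlockVector hm he hx.1 hx.2.1 hw hwmono' hw0'
      fun a h1 h2 => hp a h1 (by omega)).2 (hp (k + 2) (by omega) le_rfl)
    rw [hww] at hw'
    exact isBlockVector_injective hm (fun i => (he.2 i).1) hw hw'
  · rintro c ⟨w, ⟨hw, x, hx0, hx, hblock⟩, rfl⟩
    have hxd : x ∈ paramDomain m := by
      refine ⟨hx0, hx, ?_⟩
      have := sum_pow_of_isBlockVector hm hblock one_ne_zero
      simp only [pow_one] at this
      rw [← this, hw.2]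
    exact ⟨x, hxd, (reducedMap_eq_boundaryParam hm he.last_ne_zero hxd hblock).symm⟩

/-- Since m_i ≥ 1 for i ≥ 1, the parameter domain is a closed subset of the unit cube. -/
lemma isCompact_boundaryComponent {m : Fin (k + 2) → ℕ} (hm : ∑ i, m i = n) {e : ℕ}
    (he : IsAlternating e m) : IsCompact (boundaryComponent n m) := by
  rw [← (bijOn_boundaryParam hm he).image_eq]
  refine IsCompact.image ?_ ?_
  · refine (isCompact_Icc (a := (0 : Fin (k + 1) → ℝ)) (b := 1)).of_isClosed_subset ?_ ?_
    · have h1 : IsClosed {x : Fin (k + 1) → ℝ | ∀ i, 0 ≤ x i} := by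
        simp only [Set.ofPred_forall]
        exact isClosed_iInter fun i => isClosed_le continuous_const (continuous_apply i)
      have h2 : IsClosed {x : Fin (k + 1) → ℝ | Monotone x} := isClosed_monotone
      have h3 : IsClosed {x : Fin (k + 1) → ℝ | ∑ i, (m i.succ : ℝ) * x i = 1} :=
        isClosed_eq (by fun_prop) continuous_const
      exact h1.inter (h2.inter h3)
    · intro x hx
      refine ⟨hx.1, fun i => ?_⟩
      have h1 : (1 : ℝ) ≤ m i.succ := by exact_mod_cast (he.2 i).1
      calc x i ≤ (m i.succ : ℝ) * x i := le_mul_of_one_le_left (hx.1 i) h1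
        _ ≤ ∑ i, (m i.succ : ℝ) * x i :=
          Finset.single_le_sum (f := fun i => (m i.succ : ℝ) * x i)
            (fun i _ => mul_nonneg (Nat.cast_nonneg _) (hx.1 i)) (Finset.mem_univ i)
        _ = 1 := hx.2.2
  · refine continuous_pi fun j => ?_
    unfold boundaryParam
    fun_prop

/-- By extremality, moving only the last coordinate p_d slightly in the forbidden direction leaves
the cell. -/
lemma boundaryComponent_subset_frontier {m : Fin (k + 2) → ℕ} (hm : ∑ i, m i = n) {e : ℕ}
    (he : IsAlternating e m) : boundaryComponent n m ⊆ frontier (vandermondeCell n k) := by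
  rintro c ⟨w, ⟨hw, x, hx0, hx, hblock⟩, rfl⟩
  refine ⟨subset_closure ⟨w, hw, rfl⟩, fun hint => ?_⟩
  set c := reducedMap n k w with hc
  set s : ℝ := (-1) ^ (k + 1 + e) with hs
  have hss : s * s = 1 := by
    rw [hs, ← mul_pow]; simp
  set f : ℝ → Fin (k + 1) → ℝ := fun δ => Function.update c (Fin.last k) (c (Fin.last k) - s * δ)
    with hf
  have hf0 : f 0 = c := by simp [hf]
  have hfc : Continuous f := by
    refine Continuous.update continuous_const _ ?_
    fun_prop
  have hev : ∀ᶠ δ in 𝓝[>] (0 : ℝ), f δ ∈ vandermondeCell n k := by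
    refine nhdsWithin_le_nhds (hfc.continuousAt.eventually ?_)
    rw [hf0]
    exact mem_interior_iff_mem_nhds.1 hint
  obtain ⟨δ, ⟨w₁, hw₁, hfw₁⟩, hδ⟩ := (hev.and self_mem_nhdsWithin).exists
  obtain ⟨σ, hmono, hmem, hred⟩ := exists_monotone_reducedMap_eq (k := k) hw₁
  rw [hfw₁] at hred
  set w' := w₁ ∘ σ
  have hp : ∀ a, 1 ≤ a → a ≤ k + 1 → ∑ j, w' j ^ a = ∑ j, w j ^ a := by
    intro a ha1 hak
    rcases ha1.eq_or_lt with rfl | ha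
    · simp only [pow_one]
      rw [hw.2, hmem.2]
    · have h := congrFun hred ⟨a - 2, by omega⟩
      rw [hf, reducedMap_apply] at h
      simp only at h
      rw [Function.update_of_ne (by
        intro h; have := congrArg Fin.val h; simp at this; omega), hc, reducedMap_apply] at h
      simpa only [show a - 2 + 2 = a by omega] using h
  have h1 := (powerSum_compare_of_isBlockVector hm he hx0 hx hblock hmono hmem.1 hp).1
  have h2 := congrFun hred (Fin.last k)
  rw [hf, reducedMap_apply] at h2
  simp only [Function.update_self, hc, reducedMap_apply, Fin.val_last] at h2
  rw [h2, ← hs] at h1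
  have h3 : s * (∑ j, w j ^ (k + 2) - s * δ - ∑ j, w j ^ (k + 2)) = -(s * s * δ) := by ring
  rw [h3, hss, one_mul] at h1
  exact absurd (show 0 < δ from hδ) (by linarith)

lemma finite_multiplicityVectors : (multiplicityVectors n k).Finite := by
  refine (Set.finite_Iic (fun _ => n : Fin (k + 2) → ℕ)).subset fun m hm i => ?_
  rw [← hm.1]
  exact Finset.single_le_sum (fun _ _ => Nat.zero_le _) (Finset.mem_univ i)

lemma isClosed_iUnion_boundaryComponent :
    IsClosed (⋃ m ∈ multiplicityVectors n k, boundaryComponent n m) := by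
  refine finite_multiplicityVectors.isClosed_biUnion fun m hm => ?_
  obtain ⟨e, he⟩ := (exists_isAlternating_iff m).2 hm.2
  exact (isCompact_boundaryComponent hm.1 he).isClosed

/-- Discrete intermediate values: the first index with β ≥ b attains b, because β increases by at
most one per step. -/
lemma exists_blockIndex_eq {β : ℕ → ℕ} {K n : ℕ} (h0 : β 0 ≤ 1) (hlast : β (n - 1) = K)
    (hstep : ∀ i, β (i + 1) ≤ β i + 1) {b : ℕ} (hb : 1 ≤ b) (hbK : b ≤ K) :
    ∃ j ≤ n - 1, β j = b := by
  classical
  have hex : ∃ j, b ≤ β j := ⟨n - 1, hbK.trans hlast.ge⟩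
  refine ⟨Nat.find hex, Nat.find_min' hex (hbK.trans hlast.ge), le_antisymm ?_ (Nat.find_spec hex)⟩
  rcases hj : Nat.find hex with _ | j
  · omega
  · have h1 := Nat.find_min hex (m := j) (by omega)
    have h2 := hstep j
    omega

/-! ### Points satisfying the root and sign conditions. -/

/-- A sorted point of the simplex whose positive coordinates are roots of a nonzero polynomial of
degree at most `d - 1` satisfying the sign conditions of `exists_blockIndex` lies on a boundary
component. -/
lemma exists_mem_boundaryComponent (hkn : k + 1 ≤ n) {w : Fin n → ℝ}
    (hw : w ∈ stdSimplex ℝ (Fin n)) (hmono : Monotone w) {q : ℝ[X]} (hq : q ≠ 0)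
    (hqk : q.natDegree ≤ k + 1) (hroot : ∀ i, 0 < w i → q.IsRoot (w i))
    (hzero : ∀ i, w i = 0 → 0 ≤ q.eval 0)
    (hrep : ∀ i j, i ≠ j → w i = w j → 0 < w i → 0 ≤ q.derivative.eval (w i)) :
    ∃ m ∈ multiplicityVectors n k, reducedMap n k w ∈ boundaryComponent n m := by
  classical
  -- Continuing w by its last value keeps the sequence monotone on all of ℕ.
  set W : ℕ → ℝ := fun i => w ⟨min i (n - 1), by omega⟩ with hW
  have hWw : ∀ j : Fin n, W j = w j := fun j => by
    simp only [hW]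
    congr 1
    exact Fin.ext (min_eq_left (by omega))
  have hWmono : Monotone W := fun i j hij => hmono (by
    rw [Fin.mk_le_mk]
    exact min_le_min_right _ hij)
  obtain ⟨e, β, hβ0, hβe, hβlast, hstep, hβzero⟩ := exists_blockIndex hkn (by omega) hWmono
    (fun i => hw.1 _) hq hqk (fun i hi => hroot _ hi) (fun h => hzero _ h)
    (fun i hi heq hpos => hrep ⟨min i (n - 1), by omega⟩ ⟨min (i + 1) (n - 1), by omega⟩
      (by rw [Ne, Fin.mk.injEq]; omega) heq.symm hpos)
  have hβmono : Monotone β := monotone_nat_of_le_succ fun i => by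
    rcases hstep i with h | h <;> omega
  have hβK : ∀ j, j < n → β j < k + 2 := fun j hj => by
    have := hβmono (show j ≤ n - 1 by omega)
    omega
  have hconst : ∀ i j, i ≤ j → β i = β j → W i = W j := by
    intro i j hij
    induction j, hij using Nat.le_induction with
    | base => exact fun _ => rfl
    | succ j hij ih =>
      intro h
      have h1 := hβmono hij
      have h2 := hβmono (Nat.le_succ j)
      rcases hstep j with ⟨h3, h4, -⟩ | h3
      · rw [h4, ih (by omega)]
      · simp only [Nat.succ_eq_add_one] at h2
        omega
  have hsingle : ∀ i j, i < j → β i = β j → β i % 2 = e % 2 := by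
    intro i j hij h
    have h1 := hβmono (Nat.succ_le_of_lt hij)
    rcases hstep i with ⟨-, -, h3⟩ | h3
    · exact h3
    · simp only [Nat.succ_eq_add_one] at h1
      omega
  set B : Fin n → Fin (k + 2) := fun j => ⟨β j, hβK j j.2⟩ with hB
  have hBmono : Monotone B := fun i j hij => by
    rw [hB, Fin.mk_le_mk]
    exact hβmono hij
  have hsurj : ∀ i : Fin (k + 1), ∃ j, B j = i.succ := by
    intro i
    obtain ⟨j, hj, hji⟩ := exists_blockIndex_eq hβ0 hβlast
      (fun i => by rcases hstep i with h | h <;> omega) (b := (i.succ : Fin (k + 2)))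
      (by simp) (by omega)
    exact ⟨⟨j, by omega⟩, Fin.ext hji⟩
  choose σ hσ using hsurj
  have hBconst : ∀ i j, B i = B j → w i = w j := by
    intro i j h
    have h' : β i = β j := congrArg Fin.val h
    rw [← hWw, ← hWw]
    rcases le_total (i : ℕ) j with hij | hij
    · exact hconst _ _ hij h'
    · exact (hconst _ _ hij h'.symm).symm
  have hwB : w = fun j => (Fin.cons 0 (fun i => w (σ i)) : Fin (k + 2) → ℝ) (B j) := by
    funext j
    rcases Fin.eq_zero_or_eq_succ (B j) with h | ⟨i, h⟩
    · rw [h, Fin.cons_zero, ← hWw]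
      exact hβzero _ (congrArg Fin.val h)
    · rw [h, Fin.cons_succ]
      exact hBconst _ _ (by rw [h, hσ])
  refine ⟨fun i => (Finset.univ.filter fun j => B j = i).card, ⟨?_, ?_⟩, w,
    ⟨hw, fun i => w (σ i), fun i => hw.1 _, ?_, ?_⟩, rfl⟩
  · rw [← Finset.card_eq_sum_card_fiberwise (fun _ _ => Finset.mem_coe.2 (Finset.mem_univ _)),
      Finset.card_univ, Fintype.card_fin]
  · refine (exists_isAlternating_iff _).1 ⟨e, ?_, fun i => ⟨?_, ?_⟩⟩
    · intro he
      rw [Finset.card_eq_zero, Finset.filter_eq_empty_iff]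
      intro j _ hj
      have h1 : β j = 0 := congrArg Fin.val hj
      have h2 := hβmono (Nat.zero_le j)
      have h3 := hβe he
      omega
    · exact Finset.card_pos.2 ⟨σ i, Finset.mem_filter.2 ⟨Finset.mem_univ _, hσ i⟩⟩
    · intro hi
      refine Finset.card_eq_one.2 ⟨σ i, Finset.eq_singleton_iff_unique_mem.2
        ⟨Finset.mem_filter.2 ⟨Finset.mem_univ _, hσ i⟩, fun j hj => ?_⟩⟩
      have h1 : β j = (i.succ : Fin (k + 2)) := congrArg Fin.val (Finset.mem_filter.1 hj).2
      have h2 : β (σ i) = (i.succ : Fin (k + 2)) := congrArg Fin.val (hσ i)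
      by_contra hne
      rcases lt_or_gt_of_ne (fun h => hne (Fin.ext h) : (j : ℕ) ≠ σ i) with h | h
      · exact hi (h1 ▸ hsingle _ _ h (h1.trans h2.symm))
      · exact hi (h2 ▸ hsingle _ _ h (h2.trans h1.symm))
  · intro i j hij
    rcases hij.eq_or_lt with rfl | hlt
    · exact le_rfl
    · refine hmono (le_of_lt (not_le.1 fun h => ?_))
      have := hBmono h
      rw [hσ, hσ, Fin.succ_le_succ_iff] at this
      exact absurd hlt (not_lt.2 this)
  · have := isBlockVector_of_monotone hBmono fun i => w (σ i)
    rwa [← hwB] at this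

/-! ### Optimality conditions at a nearest point. -/

lemma eval_zero_nonneg_of_forall_Ioo {p : ℝ[X]} {δ : ℝ} (hδ : 0 < δ)
    (h : ∀ s, 0 < s → s < δ → 0 ≤ p.eval s) : 0 ≤ p.eval 0 := by
  have hcl : Set.Icc 0 δ ⊆ {s | 0 ≤ p.eval s} := by
    rw [← closure_Ioo hδ.ne]
    exact closure_minimal (fun s hs => h s hs.1 hs.2) (isClosed_le continuous_const p.continuous)
  exact hcl ⟨le_rfl, hδ.le⟩

/-- First and second order conditions for a polynomial minimized at the left end of an interval. -/
lemma derivative_nonneg_of_forall_Ioo {p : ℝ[X]} {δ : ℝ} (hδ : 0 < δ)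
    (h : ∀ s, 0 < s → s < δ → p.eval 0 ≤ p.eval s) :
    0 ≤ p.derivative.eval 0 ∧
      (p.derivative.eval 0 = 0 → 0 ≤ p.derivative.derivative.eval 0) := by
  have h1 : ∀ s, 0 < s → s < δ → 0 ≤ p.divX.eval s := by
    intro s hs0 hs
    have h2 := h s hs0 hs
    rw [← divX_mul_X_add p] at h2
    simp only [eval_add, eval_mul, eval_X, eval_C, mul_zero, zero_add] at h2
    exact nonneg_of_mul_nonneg_left (by linarith) hs0
  have hd1 : p.derivative.eval 0 = p.divX.eval 0 := by
    rw [← coeff_zero_eq_eval_zero, ← coeff_zero_eq_eval_zero, coeff_derivative, coeff_divX]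
    simp
  refine ⟨hd1 ▸ eval_zero_nonneg_of_forall_Ioo hδ h1, fun h0 => ?_⟩
  have h2 : 0 ≤ p.divX.divX.eval 0 := by
    refine eval_zero_nonneg_of_forall_Ioo hδ fun s hs0 hs => ?_
    have h3 := h1 s hs0 hs
    rw [← divX_mul_X_add p.divX, coeff_zero_eq_eval_zero, ← hd1, h0] at h3
    simp only [eval_add, eval_mul, eval_X, eval_C, add_zero] at h3
    exact nonneg_of_mul_nonneg_left h3 hs0
  have hd2 : p.derivative.derivative.eval 0 = 2 * p.divX.divX.eval 0 := by
    rw [← coeff_zero_eq_eval_zero, ← coeff_zero_eq_eval_zero, coeff_derivative, coeff_derivative,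
      coeff_divX, coeff_divX]
    norm_num
    ring
  rw [hd2]
  positivity

lemma sum_update_update {ι : Type*} [Fintype ι] [DecidableEq ι] (f : ℝ → ℝ) (w : ι → ℝ) {i j : ι}
    (hij : i ≠ j) (a b : ℝ) :
    ∑ l, f (Function.update (Function.update w i a) j b l) =
      ∑ l, f (w l) + (f b - f (w j) + (f a - f (w i))) := by
  rw [← sub_eq_iff_eq_add', ← Finset.sum_sub_distrib, Fintype.sum_eq_add i j hij]
  · simp [Function.update_of_ne hij, add_comm]
  · rintro l ⟨h1, h2⟩
    rw [Function.update_of_ne h2, Function.update_of_ne h1, sub_self]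

/-- The gradient of `w ↦ ∑ v_a p_{a+2}(w)` as a polynomial in a single coordinate. -/
noncomputable def gradientPoly (v : Fin (k + 1) → ℝ) : ℝ[X] :=
  ∑ a : Fin (k + 1), C (v a * ((a : ℕ) + 2)) * X ^ ((a : ℕ) + 1)

lemma coeff_gradientPoly (v : Fin (k + 1) → ℝ) (a : Fin (k + 1)) :
    (gradientPoly v).coeff ((a : ℕ) + 1) = v a * ((a : ℕ) + 2) := by
  simp only [gradientPoly, finsetSum_coeff, coeff_C_mul, coeff_X_pow]
  rw [Finset.sum_eq_single a]
  · simp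
  · intro b _ hb
    rw [if_neg (fun h => hb (Fin.ext (by omega))), mul_zero]
  · simp

lemma natDegree_gradientPoly_le (v : Fin (k + 1) → ℝ) : (gradientPoly v).natDegree ≤ k + 1 :=
  natDegree_sum_le_of_forall_le _ _ fun a _ => (natDegree_C_mul_X_pow_le _ _).trans (by omega)

/-- Optimality conditions for a point of the simplex whose vector of power sums is nearest to
`c`. -/
lemma gradientPoly_optimality {c : Fin (k + 1) → ℝ} {w : Fin n → ℝ}
    (hw : w ∈ stdSimplex ℝ (Fin n))
    (hmin : ∀ w' ∈ stdSimplex ℝ (Fin n), ∑ a, (reducedMap n k w a - c a) ^ 2 ≤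
      ∑ a, (reducedMap n k w' a - c a) ^ 2) {i j : Fin n} (hij : i ≠ j) (hi : 0 < w i) :
    (gradientPoly fun a => reducedMap n k w a - c a).eval (w i) ≤
        (gradientPoly fun a => reducedMap n k w a - c a).eval (w j) ∧
      (w i = w j →
        0 ≤ (gradientPoly fun a => reducedMap n k w a - c a).derivative.eval (w i)) := by
  set v : Fin (k + 1) → ℝ := fun a => reducedMap n k w a - c a with hv
  -- The squared distance to c, as a polynomial in the mass s moved from coordinate i to coordinate
  -- j.
  set p : ℝ[X] := ∑ a : Fin (k + 1), (C (v a) + ((X + C (w j)) ^ ((a : ℕ) + 2) -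
    C (w j ^ ((a : ℕ) + 2)) + ((C (w i) - X) ^ ((a : ℕ) + 2) - C (w i ^ ((a : ℕ) + 2))))) ^ 2
    with hp
  have hpmin : ∀ s, 0 < s → s < w i → p.eval 0 ≤ p.eval s := by
    intro s hs0 hs
    have hmem : Function.update (Function.update w i (w i - s)) j (s + w j) ∈
        stdSimplex ℝ (Fin n) := by
      constructor
      · intro l
        by_cases h1 : l = j
        · subst h1
          rw [Function.update_self]
          exact add_nonneg hs0.le (hw.1 l)
        · rw [Function.update_of_ne h1]
          by_cases h2 : l = i
          · subst h2
            rw [Function.update_self]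
            linarith
          · rw [Function.update_of_ne h2]
            exact hw.1 l
      · have := sum_update_update id w hij (w i - s) (s + w j)
        simp only [id] at this
        rw [this, hw.2]
        ring
    have h0 : p.eval 0 = ∑ a, (reducedMap n k w a - c a) ^ 2 := by
      simp [hp, hv, eval_finsetSum]
    have h1 : p.eval s = ∑ a, (reducedMap n k
        (Function.update (Function.update w i (w i - s)) j (s + w j)) a - c a) ^ 2 := by
      rw [hp, eval_finsetSum]
      refine Finset.sum_congr rfl fun a _ => ?_
      rw [reducedMap_apply,
        sum_update_update (fun t => t ^ ((a : ℕ) + 2)) w hij (w i - s) (s + w j), ← reducedMap_apply]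
      simp only [eval_pow, eval_add, eval_sub, eval_C, eval_X, hv]
      ring
    rw [h0, h1]
    exact hmin _ hmem
  have hd1 : p.derivative.eval 0 =
      2 * ((gradientPoly v).eval (w j) - (gradientPoly v).eval (w i)) := by
    rw [hp, gradientPoly, derivative_sum, eval_finsetSum, eval_finsetSum, eval_finsetSum,
      ← Finset.sum_sub_distrib, Finset.mul_sum]
    refine Finset.sum_congr rfl fun a _ => ?_
    simp [derivative_pow]
    ring
  -- For equal coordinates the first variation of every power sum vanishes, so the squared
  -- first-order terms drop out of the second derivative.
  have hd2 : w i = w j → p.derivative.derivative.eval 0 =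
      4 * (gradientPoly v).derivative.eval (w i) := by
    intro heq
    rw [hp, gradientPoly, derivative_sum, derivative_sum, derivative_sum, eval_finsetSum,
      eval_finsetSum, Finset.mul_sum]
    refine Finset.sum_congr rfl fun a _ => ?_
    simp [derivative_pow, ← heq]
    ring
  obtain ⟨h1, h2⟩ := derivative_nonneg_of_forall_Ioo hi hpmin
  rw [hd1] at h1 h2
  refine ⟨by linarith, fun heq => ?_⟩
  have h3 := h2 (by rw [heq]; ring)
  rw [hd2 heq] at h3
  linarith

/-- The power sums of a point of the simplex that is nearest to a point outside of the cell lie on a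
boundary component. -/
lemma exists_mem_boundaryComponent_of_nearest (hkn : k + 1 ≤ n) {c : Fin (k + 1) → ℝ}
    (hc : c ∉ vandermondeCell n k) {w : Fin n → ℝ} (hw : w ∈ stdSimplex ℝ (Fin n))
    (hmin : ∀ w' ∈ stdSimplex ℝ (Fin n), ∑ a, (reducedMap n k w a - c a) ^ 2 ≤
      ∑ a, (reducedMap n k w' a - c a) ^ 2) :
    ∃ m ∈ multiplicityVectors n k, reducedMap n k w ∈ boundaryComponent n m := by
  obtain ⟨σ, hmono, hmem, hred⟩ := exists_monotone_reducedMap_eq (k := k) hw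
  rw [← hred] at hmin ⊢
  have hcu : reducedMap n k (w ∘ σ) ≠ c := fun h => hc ⟨_, hmem, h⟩
  generalize w ∘ σ = u at hmono hmem hmin hcu
  set G := gradientPoly fun a => reducedMap n k u a - c a with hG
  obtain ⟨i₀, hi₀⟩ : ∃ i, 0 < u i := by
    by_contra! h
    have := Finset.sum_nonpos fun i (_ : i ∈ Finset.univ) => h i
    rw [hmem.2] at this
    linarith
  obtain ⟨a, ha⟩ := Function.ne_iff.1 hcu
  have hle : ∀ i j, 0 < u i → G.eval (u i) ≤ G.eval (u j) := by
    intro i j hi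
    by_cases hij : i = j
    · rw [hij]
    · exact (gradientPoly_optimality hmem hmin hij hi).1
  -- Subtracting the common value of G at positive coordinates affects only the constant term; a
  -- nonzero coefficient remains because c differs from the power sums of u.
  refine exists_mem_boundaryComponent hkn hmem hmono (q := G - C (G.eval (u i₀))) ?_ ?_ ?_ ?_ ?_
  · intro h0
    have h1 := congrArg (fun p : ℝ[X] => p.coeff ((a : ℕ) + 1)) h0
    simp only [coeff_sub, coeff_C_succ, sub_zero, coeff_zero, hG, coeff_gradientPoly] at h1
    rcases mul_eq_zero.1 h1 with h2 | h2
    · exact ha (sub_eq_zero.1 h2)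
    · have : (0 : ℝ) < (a : ℕ) + 2 := by positivity
      exact this.ne' h2
  · rw [natDegree_sub_C]
    exact natDegree_gradientPoly_le _
  · intro i hi
    rw [IsRoot, eval_sub, eval_C, sub_eq_zero]
    exact le_antisymm (hle i i₀ hi) (hle i₀ i hi₀)
  · intro i hi
    rw [eval_sub, eval_C, sub_nonneg, ← hi]
    exact hle i₀ i hi₀
  · intro i j hij heq hi
    rw [derivative_sub, derivative_C, sub_zero]
    exact (gradientPoly_optimality hmem hmin hij hi).2 heq

/-! ### Approximation of frontier points by nearest points. -/

lemma frontier_subset_iUnion_boundaryComponent (hkn : k + 1 ≤ n) :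
    frontier (vandermondeCell n k) ⊆
      ⋃ m ∈ multiplicityVectors n k, boundaryComponent n m := by
  intro c hc
  obtain ⟨w, hw, rfl⟩ := isCompact_vandermondeCell.isClosed.frontier_subset hc
  rw [← isClosed_iUnion_boundaryComponent.closure_eq, Metric.mem_closure_iff]
  intro ε hε
  rw [← frontier_compl] at hc
  -- With η = ε/(k + 3), passing from the sup distance to the sum of squares and back costs at most
  -- a factor k + 1, so the nearest point is within (k + 1)η of c and within (k + 2)η < ε of the
  -- frontier point.
  have hη : 0 < ε / (k + 3) := by positivity
  obtain ⟨c, hcmem, hdist⟩ := Metric.mem_closure_iff.1 (frontier_subset_closure hc) _ hη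
  have hcont : Continuous fun w : Fin n → ℝ => ∑ a, (reducedMap n k w a - c a) ^ 2 :=
    continuous_finsetSum _ fun a _ =>
      (((continuous_apply a).comp continuous_reducedMap).sub continuous_const).pow 2
  obtain ⟨u, hu, humin⟩ := (isCompact_stdSimplex ℝ (Fin n)).exists_isMinOn ⟨w, hw⟩
    hcont.continuousOn
  obtain ⟨m, hm, hum⟩ := exists_mem_boundaryComponent_of_nearest hkn hcmem hu fun w' hw' =>
    humin hw'
  refine ⟨reducedMap n k u, Set.mem_biUnion hm hum, ?_⟩
  have h1 : ∑ a, (reducedMap n k u a - c a) ^ 2 ≤ ((k + 1) * (ε / (k + 3))) ^ 2 := by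
    refine (humin hw).trans ?_
    calc ∑ a, (reducedMap n k w a - c a) ^ 2 ≤ ∑ _a : Fin (k + 1), (ε / (k + 3)) ^ 2 := by
          refine Finset.sum_le_sum fun a _ => ?_
          rw [← sq_abs, ← Real.dist_eq]
          exact pow_le_pow_left₀ dist_nonneg ((dist_le_pi_dist _ _ a).trans hdist.le) 2
      _ = (k + 1) * (ε / (k + 3)) ^ 2 := by simp
      _ ≤ (k + 1) ^ 2 * (ε / (k + 3)) ^ 2 := by
          refine mul_le_mul_of_nonneg_right ?_ (sq_nonneg _)
          exact le_self_pow₀ (by linarith [Nat.cast_nonneg (α := ℝ) k]) two_ne_zero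
      _ = ((k + 1) * (ε / (k + 3))) ^ 2 := (mul_pow _ _ _).symm
  have h2 : dist (reducedMap n k u) c ≤ (k + 1) * (ε / (k + 3)) := by
    refine (dist_pi_le_iff (by positivity)).2 fun a => ?_
    rw [Real.dist_eq]
    refine abs_le_of_sq_le_sq ?_ (by positivity)
    exact (Finset.single_le_sum (f := fun a => (reducedMap n k u a - c a) ^ 2)
      (fun a _ => sq_nonneg _) (Finset.mem_univ a)).trans h1
  have h3 : (k + 2) * (ε / (k + 3)) < ε := by
    rw [mul_div_assoc', div_lt_iff₀ (by positivity)]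
    nlinarith
  have h4 := dist_triangle_right (reducedMap n k w) (reducedMap n k u) c
  linarith

end Vandermonde

theorem mainTheorem6 (n k : ℕ) (hn : k + 1 ≤ n) :
    frontier (Vandermonde.vandermondeCell n k) =
        ⋃ m ∈ Vandermonde.multiplicityVectors n k, Vandermonde.boundaryComponent n m ∧
      ∀ m ∈ Vandermonde.multiplicityVectors n k,
        Set.BijOn (Vandermonde.boundaryParam m) (Vandermonde.paramDomain m)
          (Vandermonde.boundaryComponent n m) := by
  refine ⟨(Vandermonde.frontier_subset_iUnion_boundaryComponent hn).antisymm
    (Set.iUnion₂_subset fun m hm => ?_), fun m hm => ?_⟩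
  · obtain ⟨e, he⟩ := (Vandermonde.exists_isAlternating_iff m).2 hm.2
    exact Vandermonde.boundaryComponent_subset_frontier hm.1 he
  · obtain ⟨e, he⟩ := (Vandermonde.exists_isAlternating_iff m).2 hm.2
    exact Vandermonde.bijOn_boundaryParam hm.1 he
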